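/- Let $X$ be a compact topological space with its Borel $\sigma$-algebra, let $\mathcal P(X)$ be the space of Borel probability measures on $X$ with the weak topology, and let $\mu_0\in\mathcal P(X)$. Let $E:\mathcal P(X)\to\,]-\infty,\infty]$ be a lower semicontinuous convex functional with $e_0:=E(\mu_0)<\infty$, and set $e_{\min}:=\inf_{\mathcal P(X)}E$. For $\mu\in\mathcal P(X)$ let $S(\mu):=-\int_X\log\frac{d\mu}{d\mu_0}\,d\mu\in[-\infty,0]$ be the entropy of $\mu$ relative to $\mu_0$ (equal to $-\infty$ if $\mu$ is not absolutely continuous with respect to $\mu_0$). For $e\in\mathbb R$ and $\beta\in\mathbb R$ put $$S(e):=\sup\{S(\mu):\mu\in\mathcal P(X),\ E(\mu)=e\},\qquad F(\beta):=\inf_{\mu\in\mathcal P(X)}F_\beta(\mu),\qquad F^*(e):=\inf_{\beta\in\mathbb R}\bigl(\beta e-F(\beta)\bigr),$$ where $\sup\emptyset=-\infty$ and $F_\beta(\mu):=\beta E(\mu)-S(\mu)$, with $F_\beta(\mu):=+\infty$ if $S(\mu)=-\infty$ (and the convention $0\cdot\infty=0$). Assume the energy approximation property: for every $\mu\in\mathcal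 P(X)$ there is a sequence $\mu_j\in\mathcal P(X)$ converging weakly to $\mu$, with each $\mu_j$ absolutely continuous with respect to $\mu_0$ and of finite entropy, $S(\mu_j)>-\infty$, such that $E(\mu_j)\to E(\mu)$. Then $S(e)$ is finite on $]e_{\min},e_0]$; it is strictly concave on $]e_{\min},e_0[$ and satisfies $S(e)=F^*(e)$ for every $e\in\,]e_{\min},e_0[$. Moreover, $S(e)$ is continuous on $]e_{\min},e_0]$. -/

import Mathlib

open MeasureTheory Filter Topology
open scoped NNReal ENNReal

noncomputable section

namespace MeanField

variable {X : Type*} [MeasurableSpace X]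

/-- The relative entropy `S(μ) = -∫ log (dμ/dμ₀) dμ` of `μ` with respect to the prior `μ₀`, with the
value `-∞` when `μ` is not absolutely continuous (or the integral diverges). -/
def relEntropy (μ₀ μ : ProbabilityMeasure X) : EReal :=
  -((InformationTheory.klDiv (μ : Measure X) (μ₀ : Measure X) : ℝ≥0∞) : EReal)

/-- The convex combination `a μ + b ν` of two probability measures. -/
def mix (a b : ℝ≥0) (hab : a + b = 1) (μ ν : ProbabilityMeasure X) : ProbabilityMeasure X :=
  ⟨a • (μ : Measure X) + b • (ν : Measure X), ⟨by
    have h : (a : ℝ≥0∞) + (b : ℝ≥0∞) = 1 := by exact_mod_cast hab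
    rw [Measure.add_apply, Measure.smul_apply, Measure.smul_apply, measure_univ, measure_univ,
      ENNReal.smul_def, ENNReal.smul_def, smul_eq_mul, smul_eq_mul, mul_one, mul_one, h]⟩⟩

/-- Convexity of a functional with values in `]-∞, ∞]` on the space of probability measures. -/
def IsConvexFunctional (E : ProbabilityMeasure X → EReal) : Prop :=
  ∀ (μ ν : ProbabilityMeasure X) (a b : ℝ≥0) (hab : a + b = 1),
    E (mix a b hab μ ν) ≤ ((a : ℝ) : EReal) * E μ + ((b : ℝ) : EReal) * E ν

/-- The minimal energy `e_min`. On a compact space every probability measure is compactly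
supported, so that the infimum runs over all of `P(X)`. -/
def eMin (E : ProbabilityMeasure X → EReal) : EReal := ⨅ μ, E μ

/-- The microcanonical entropy `S(e) = sup {S(μ) : E(μ) = e}`, equal to `-∞` when no measure has
energy `e`. -/
def entropy (E : ProbabilityMeasure X → EReal) (μ₀ : ProbabilityMeasure X) (e : ℝ) : EReal :=
  ⨆ (μ : ProbabilityMeasure X) (_ : E μ = (e : EReal)), relEntropy μ₀ μ

open scoped Classical in
/-- The free energy functional `F_β(μ) = β E(μ) - S(μ)`, equal to `+∞` when `S(μ) = -∞`. -/
def freeEnergyFunctional (E : ProbabilityMeasure X → EReal) (μ₀ : ProbabilityMeasure X) (β : ℝ)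
    (μ : ProbabilityMeasure X) : EReal :=
  if relEntropy μ₀ μ = ⊥ then ⊤ else (β : EReal) * E μ - relEntropy μ₀ μ

/-- The free energy `F(β) = inf_μ F_β(μ)` at inverse temperature `β`. -/
def freeEnergy (E : ProbabilityMeasure X → EReal) (μ₀ : ProbabilityMeasure X) (β : ℝ) : EReal :=
  ⨅ μ, freeEnergyFunctional E μ₀ β μ

/-- The concave Legendre-Fenchel transform `f*(y) = inf_x (x y - f(x))`. -/
def legendre (f : ℝ → EReal) (y : ℝ) : EReal :=
  ⨅ x : ℝ, ((x * y : ℝ) : EReal) - f x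

/-- The energy approximation property: every probability measure is a weak limit of a sequence of
absolutely continuous measures of finite entropy whose energies converge. -/
def EnergyApproximation [TopologicalSpace X] [OpensMeasurableSpace X]
    (E : ProbabilityMeasure X → EReal) (μ₀ : ProbabilityMeasure X) : Prop :=
  ∀ μ : ProbabilityMeasure X, ∃ ν : ℕ → ProbabilityMeasure X,
    Tendsto ν atTop (𝓝 μ) ∧
    (∀ j, (ν j : Measure X) ≪ (μ₀ : Measure X) ∧ relEntropy μ₀ (ν j) ≠ ⊥) ∧
    Tendsto (fun j => E (ν j)) atTop (𝓝 (E μ))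

end MeanField

end

/-! Everything rests on replacing the constraint `E μ = e` by `E μ ≤ e`. For `e_min < e ≤ e₀`, the
sublevel set is convex, weakly sequentially closed by lower semicontinuity, and contains a measure
of finite entropy by energy approximation. The divergence `kl` is uniformly convex: its convexity
gap controls the squared `L¹` distance of the densities (`kl_mix_add_le`). A minimizing sequence is
therefore Cauchy in `L¹`, and Fatou's lemma makes its limit a minimizer (`exists_kl_minimizer`).
Sliding the minimizer along the segment to `μ₀`, where `kl` vanishes, raises the energy to exactly
`e` without increasing `kl` (`exists_isMaximizer`). Hence `-S(e)` is the minimum of `kl` over `{E ≤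
e}` and is attained with energy `e`.

The rest is convex analysis. Mixing maximizers gives concavity, strict because distinct energies
force distinct measures. Comparing difference quotients on the two sides of `e` yields a positive
supergradient `β`, hence `S = F*`. Concavity gives continuity in the interior; at `e₀`, where `S =
0`, a chord from below and `S ≤ 0` squeeze the limit. -/

namespace MeanField

open InformationTheory

/-! ### Pointwise uniform convexity of `klFun` -/

/-- The klFun divergence dominates the squared Hellinger distance, hence every linear lower bound of
the distance to `1`. -/
lemma le_klFun {u : ℝ} (hu : 0 ≤ u) (s : ℝ) :
    s * |u - 1| - s ^ 2 / 2 * (u + 1) ≤ klFun u := by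
  obtain ⟨r, hr, rfl⟩ : ∃ r : ℝ, 0 ≤ r ∧ u = r ^ 2 := ⟨√u, Real.sqrt_nonneg u, (Real.sq_sqrt hu).symm⟩
  -- Insert `log r ≥ 1 - 1/r` into `2 r² log r + 1 - r²`.
  have hkl : (r - 1) ^ 2 ≤ klFun (r ^ 2) := by
    rcases hr.eq_or_lt with rfl | hr
    · simp [klFun]
    · have h := Real.one_sub_inv_le_log_of_pos hr
      have h2 : r ^ 2 * (1 - r⁻¹) ≤ r ^ 2 * Real.log r := by gcongr
      have h3 : r ^ 2 * (1 - r⁻¹) = r ^ 2 - r := by field_simp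
      rw [klFun, Real.log_pow]
      push_cast
      linarith
  have habs : |r ^ 2 - 1| = |r - 1| * (r + 1) := by
    rw [show r ^ 2 - 1 = (r - 1) * (r + 1) by ring, abs_mul, abs_of_nonneg (by positivity : 0 ≤ r + 1)]
  rw [habs]
  -- Young's inequality, followed by `(r + 1)² = 2 (r² + 1) - (r - 1)²`.
  nlinarith [sq_nonneg (|r - 1| - s / 2 * (r + 1)), sq_abs (r - 1),
    mul_nonneg (sq_nonneg s) (sq_nonneg (r - 1))]

/-- Quantitative lower bound of `klFun` by its tangent line. -/
lemma tangent_le_klFun {x m : ℝ} (hx : 0 ≤ x) (hm : 0 < m) (s : ℝ) :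
    klFun m + Real.log m * (x - m) + (s * |x - m| - s ^ 2 / 2 * (x + m)) ≤ klFun x := by
  have h := mul_le_mul_of_nonneg_left (le_klFun (u := x / m) (by positivity) s) hm.le
  have habs : |x / m - 1| = |x - m| / m := by
    rw [← abs_of_pos hm, ← abs_div, abs_of_pos hm, sub_div, div_self hm.ne']
  have h1 : m * (s * |x / m - 1| - s ^ 2 / 2 * (x / m + 1))
      = s * |x - m| - s ^ 2 / 2 * (x + m) := by
    rw [habs]; field_simp
  rw [h1] at h
  -- The rescaled `klFun` is its Bregman divergence, since `klFun' = log`.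
  have h2 : m * klFun (x / m) = klFun x - klFun m - Real.log m * (x - m) := by
    rcases hx.eq_or_lt with rfl | hx
    · simp [klFun]; ring
    · simp only [klFun]
      rw [Real.log_div hx.ne' hm.ne']
      field_simp
      ring
  linarith

/-- Uniform convexity of `klFun`. -/
lemma klFun_mix_le {x y a b : ℝ} (hx : 0 ≤ x) (hy : 0 ≤ y) (ha : 0 ≤ a) (hb : 0 ≤ b)
    (hab : a + b = 1) (s : ℝ) :
    klFun (a * x + b * y) + (2 * (a * b) * s * |x - y| - s ^ 2 * (a * x + b * y))
      ≤ a * klFun x + b * klFun y := by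
  obtain rfl : b = 1 - a := by linarith
  rcases (by positivity : 0 ≤ a * x + (1 - a) * y).eq_or_lt with hm | hm
  · have h1 : a * x = 0 := by nlinarith [mul_nonneg ha hx, mul_nonneg hb hy]
    have h2 : (1 - a) * y = 0 := by linarith
    rcases mul_eq_zero.1 h1 with rfl | rfl <;> rcases mul_eq_zero.1 h2 with h | rfl
    · norm_num at h
    · simp
    · obtain rfl : a = 1 := by linarith
      simp
    · simp [klFun_zero]
  · have h1 := tangent_le_klFun hx hm s
    have h2 := tangent_le_klFun hy hm s
    have e1 : |x - (a * x + (1 - a) * y)| = (1 - a) * |x - y| := by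
      rw [← abs_of_nonneg hb, ← abs_mul, abs_of_nonneg hb]; ring_nf
    have e2 : |y - (a * x + (1 - a) * y)| = a * |x - y| := by
      rw [← abs_neg, ← abs_of_nonneg ha, ← abs_mul, abs_of_nonneg ha]; ring_nf
    rw [e1] at h1
    rw [e2] at h2
    -- The tangent terms cancel on averaging, as `m` is the barycentre.
    have h3 := add_le_add (mul_le_mul_of_nonneg_left h1 ha) (mul_le_mul_of_nonneg_left h2 hb)
    refine le_trans (le_of_eq ?_) h3
    ring

/-! ### Uniform convexity of the divergence -/

variable {X : Type*} [MeasurableSpace X]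

/-- The density of `μ` with respect to `μ₀`. -/
noncomputable def density (μ₀ μ : ProbabilityMeasure X) (x : X) : ℝ :=
  ((μ : Measure X).rnDeriv (μ₀ : Measure X) x).toReal

/-- The real value of the Kullback-Leibler divergence. -/
noncomputable def kl (μ₀ μ : ProbabilityMeasure X) : ℝ :=
  (klDiv (μ : Measure X) (μ₀ : Measure X)).toReal

/-- The absolutely continuous measures of finite entropy. -/
def FiniteEntropy (μ₀ μ : ProbabilityMeasure X) : Prop :=
  klDiv (μ : Measure X) (μ₀ : Measure X) ≠ ⊤

variable {μ₀ μ ν : ProbabilityMeasure X}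

lemma density_nonneg (x : X) : 0 ≤ density μ₀ μ x := ENNReal.toReal_nonneg

@[fun_prop]
lemma measurable_density : Measurable (density μ₀ μ) := by
  unfold density; fun_prop

lemma integrable_density : Integrable (density μ₀ μ) μ₀ := Measure.integrable_toReal_rnDeriv

lemma FiniteEntropy.ac (h : FiniteEntropy μ₀ μ) : (μ : Measure X) ≪ μ₀ := (klDiv_ne_top_iff.1 h).1

lemma FiniteEntropy.integral_density (h : FiniteEntropy μ₀ μ) : ∫ x, density μ₀ μ x ∂μ₀ = 1 := by
  unfold density
  rw [Measure.integral_toReal_rnDeriv h.ac]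
  simp

lemma FiniteEntropy.integral_mul_density (h : FiniteEntropy μ₀ μ) (g : X → ℝ) :
    ∫ x, density μ₀ μ x * g x ∂μ₀ = ∫ x, g x ∂μ := by
  simpa [density] using integral_rnDeriv_smul h.ac (f := g)

lemma FiniteEntropy.integrable_klFun (h : FiniteEntropy μ₀ μ) :
    Integrable (fun x => klFun (density μ₀ μ x)) μ₀ :=
  (integrable_klFun_rnDeriv_iff h.ac).2 (klDiv_ne_top_iff.1 h).2

lemma FiniteEntropy.kl_eq (h : FiniteEntropy μ₀ μ) :
    kl μ₀ μ = ∫ x, klFun (density μ₀ μ x) ∂μ₀ := toReal_klDiv_eq_integral_klFun h.ac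

lemma kl_nonneg : 0 ≤ kl μ₀ μ := ENNReal.toReal_nonneg

lemma finiteEntropy_self : FiniteEntropy μ₀ μ₀ := by simp [FiniteEntropy]

lemma kl_self : kl μ₀ μ₀ = 0 := by simp [kl]

lemma FiniteEntropy.eq_of_kl_nonpos (h : FiniteEntropy μ₀ μ) (h0 : kl μ₀ μ ≤ 0) : μ = μ₀ := by
  have : klDiv (μ : Measure X) (μ₀ : Measure X) = 0 := by
    rcases (ENNReal.toReal_eq_zero_iff _).1 (le_antisymm h0 kl_nonneg) with h' | h'
    · exact h'
    · exact absurd h' h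
  have hm : (μ : Measure X) = μ₀ := klDiv_eq_zero_iff.1 this
  exact Subtype.ext hm

lemma relEntropy_ne_bot_iff : relEntropy μ₀ μ ≠ ⊥ ↔ FiniteEntropy μ₀ μ := by
  simp [relEntropy, FiniteEntropy, EReal.neg_eq_bot_iff]

lemma FiniteEntropy.relEntropy_eq (h : FiniteEntropy μ₀ μ) :
    relEntropy μ₀ μ = ((-kl μ₀ μ : ℝ) : EReal) := by
  rw [relEntropy, EReal.coe_neg, kl, EReal.coe_ennreal_toReal h]

lemma mix_toMeasure (a b : ℝ≥0) (hab : a + b = 1) :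
    (mix a b hab μ ν : Measure X) = a • (μ : Measure X) + b • (ν : Measure X) := rfl

lemma density_mix (a b : ℝ≥0) (hab : a + b = 1) :
    density μ₀ (mix a b hab μ ν) =ᵐ[(μ₀ : Measure X)]
      fun x => a * density μ₀ μ x + b * density μ₀ ν x := by
  have h1 := Measure.rnDeriv_add' (a • (μ : Measure X)) (b • (ν : Measure X)) (μ₀ : Measure X)
  have h2 := Measure.rnDeriv_smul_left' (μ : Measure X) (μ₀ : Measure X) a
  have h3 := Measure.rnDeriv_smul_left' (ν : Measure X) (μ₀ : Measure X) b
  filter_upwards [h1, h2, h3, Measure.rnDeriv_lt_top (μ : Measure X) (μ₀ : Measure X),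
    Measure.rnDeriv_lt_top (ν : Measure X) (μ₀ : Measure X)] with x h1 h2 h3 h4 h5
  simp only [density, mix_toMeasure]
  rw [h1, Pi.add_apply, h2, h3, Pi.smul_apply, Pi.smul_apply, ENNReal.smul_def, ENNReal.smul_def,
    smul_eq_mul, smul_eq_mul, ENNReal.toReal_add (by finiteness) (by finiteness)]
  simp

lemma FiniteEntropy.mix (hμ : FiniteEntropy μ₀ μ) (hν : FiniteEntropy μ₀ ν) (a b : ℝ≥0)
    (hab : a + b = 1) : FiniteEntropy μ₀ (mix a b hab μ ν) := by
  have hac : (MeanField.mix a b hab μ ν : Measure X) ≪ μ₀ :=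
    Measure.AbsolutelyContinuous.add_left (hμ.ac.smul_left a) (hν.ac.smul_left b)
  have habR : (a : ℝ) + b = 1 := by exact_mod_cast hab
  refine klDiv_ne_top hac ((integrable_klFun_rnDeriv_iff hac).1 ?_)
  refine ((hμ.integrable_klFun.const_mul (a : ℝ)).add (hν.integrable_klFun.const_mul (b : ℝ))).mono'
    (measurable_klFun.comp measurable_density).aestronglyMeasurable ?_
  filter_upwards [density_mix (μ₀ := μ₀) (μ := μ) (ν := ν) a b hab] with x hx
  change ‖klFun (density μ₀ (MeanField.mix a b hab μ ν) x)‖ ≤ _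
  rw [Real.norm_of_nonneg (klFun_nonneg (density_nonneg x)), hx]
  simpa using klFun_mix_le (density_nonneg x) (density_nonneg x) a.2 b.2 habR 0

/-- Uniform convexity of the Kullback-Leibler divergence. -/
lemma kl_mix_add_le (hμ : FiniteEntropy μ₀ μ) (hν : FiniteEntropy μ₀ ν) (a b : ℝ≥0)
    (hab : a + b = 1) :
    kl μ₀ (mix a b hab μ ν) + (a * b * ∫ x, |density μ₀ μ x - density μ₀ ν x| ∂μ₀) ^ 2
      ≤ a * kl μ₀ μ + b * kl μ₀ ν := by
  have habR : (a : ℝ) + b = 1 := by exact_mod_cast hab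
  set d := ∫ x, |density μ₀ μ x - density μ₀ ν x| ∂μ₀ with hd
  -- After integration the gain is `2abds - s²`, because the mixed density has mass one; this `s`
  -- maximizes it.
  set s : ℝ := a * b * d with hs
  have hI : Integrable (fun x => |density μ₀ μ x - density μ₀ ν x|) μ₀ :=
    (integrable_density.sub integrable_density).abs
  have hm := (hμ.mix hν a b hab)
  have h1 : ∫ x, (klFun (density μ₀ (mix a b hab μ ν) x) +
      (2 * (a * b) * s * |density μ₀ μ x - density μ₀ ν x|
        - s ^ 2 * density μ₀ (mix a b hab μ ν) x)) ∂μ₀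
      ≤ ∫ x, (a * klFun (density μ₀ μ x) + b * klFun (density μ₀ ν x)) ∂μ₀ := by
    refine integral_mono_ae (hm.integrable_klFun.add ((hI.const_mul _).sub
      (integrable_density.const_mul _)))
      ((hμ.integrable_klFun.const_mul _).add (hν.integrable_klFun.const_mul _)) ?_
    filter_upwards [density_mix (μ₀ := μ₀) (μ := μ) (ν := ν) a b hab] with x hx
    rw [hx]
    exact klFun_mix_le (density_nonneg x) (density_nonneg x) a.2 b.2 habR s
  have hI2 : Integrable (fun x => 2 * (a * b) * s * |density μ₀ μ x - density μ₀ ν x|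
        - s ^ 2 * density μ₀ (mix a b hab μ ν) x) μ₀ :=
    (hI.const_mul _).sub (integrable_density.const_mul _)
  rw [integral_add hm.integrable_klFun hI2, integral_sub (hI.const_mul _) (integrable_density.const_mul _),
    integral_add (hμ.integrable_klFun.const_mul _) (hν.integrable_klFun.const_mul _),
    integral_const_mul, integral_const_mul, integral_const_mul, integral_const_mul,
    hm.integral_density, ← hm.kl_eq, ← hμ.kl_eq, ← hν.kl_eq, ← hd] at h1
  refine le_trans (le_of_eq ?_) h1
  rw [hs]; ring

lemma kl_mix_le (hμ : FiniteEntropy μ₀ μ) (hν : FiniteEntropy μ₀ ν) (a b : ℝ≥0)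
    (hab : a + b = 1) : kl μ₀ (mix a b hab μ ν) ≤ a * kl μ₀ μ + b * kl μ₀ ν :=
  le_trans (le_add_of_nonneg_right (sq_nonneg _)) (kl_mix_add_le hμ hν a b hab)

lemma FiniteEntropy.eq_of_integral_abs_sub_density (hμ : FiniteEntropy μ₀ μ)
    (hν : FiniteEntropy μ₀ ν) (h : ∫ x, |density μ₀ μ x - density μ₀ ν x| ∂μ₀ = 0) : μ = ν := by
  have h0 := (integral_eq_zero_iff_of_nonneg (fun x => abs_nonneg _)
    (integrable_density.sub integrable_density).abs).1 h
  have h1 : (μ : Measure X).rnDeriv μ₀ =ᵐ[(μ₀ : Measure X)] (ν : Measure X).rnDeriv μ₀ := by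
    filter_upwards [h0, Measure.rnDeriv_lt_top (μ : Measure X) (μ₀ : Measure X),
      Measure.rnDeriv_lt_top (ν : Measure X) (μ₀ : Measure X)] with x h1 h2 h3
    simp only [Pi.sub_apply, Pi.zero_apply, abs_eq_zero, sub_eq_zero] at h1
    exact (ENNReal.toReal_eq_toReal_iff' h2.ne h3.ne).1 h1
  refine Subtype.ext ?_
  change (μ : Measure X) = (ν : Measure X)
  rw [← Measure.withDensity_rnDeriv_eq _ _ hμ.ac, ← Measure.withDensity_rnDeriv_eq _ _ hν.ac]
  exact withDensity_congr_ae h1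

lemma kl_mix_lt (hμ : FiniteEntropy μ₀ μ) (hν : FiniteEntropy μ₀ ν) (hne : μ ≠ ν) {a b : ℝ≥0}
    (ha : 0 < a) (hb : 0 < b) (hab : a + b = 1) :
    kl μ₀ (mix a b hab μ ν) < a * kl μ₀ μ + b * kl μ₀ ν := by
  refine lt_of_lt_of_le (lt_add_of_pos_right _ ?_) (kl_mix_add_le hμ hν a b hab)
  have hd : ∫ x, |density μ₀ μ x - density μ₀ ν x| ∂μ₀ ≠ 0 :=
    fun h => hne (hμ.eq_of_integral_abs_sub_density hν h)
  have : (a : ℝ) ≠ 0 := by exact_mod_cast ha.ne'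
  have : (b : ℝ) ≠ 0 := by exact_mod_cast hb.ne'
  positivity

end MeanField

/-! ### Minimizing the divergence over closed convex sets -/

namespace MeanField
open InformationTheory

variable {X : Type*} [MeasurableSpace X] {μ₀ μ ν : ProbabilityMeasure X}

lemma FiniteEntropy.lintegral_klFun (h : FiniteEntropy μ₀ μ) :
    ∫⁻ x, ENNReal.ofReal (klFun (density μ₀ μ x)) ∂μ₀ = ENNReal.ofReal (kl μ₀ μ) := by
  rw [h.kl_eq, ofReal_integral_eq_lintegral_ofReal h.integrable_klFun
    (ae_of_all _ fun x => klFun_nonneg (density_nonneg x))]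

/-- Measures whose densities form a fast Cauchy sequence in `L¹` converge weakly, and the
Kullback-Leibler divergence is lower semicontinuous along the sequence. -/
lemma exists_tendsto_of_cauchy_density [TopologicalSpace X] [OpensMeasurableSpace X]
    {u : ℕ → ProbabilityMeasure X} (hu : ∀ n, FiniteEntropy μ₀ (u n)) {d : ℝ}
    (hd : Tendsto (fun n => kl μ₀ (u n)) atTop (𝓝 d))
    (hc : ∀ N n m : ℕ, N ≤ n → N ≤ m →
      ∫ x, |density μ₀ (u n) x - density μ₀ (u m) x| ∂μ₀ < (1 / 2) ^ N) :
    ∃ μ, FiniteEntropy μ₀ μ ∧ kl μ₀ μ ≤ d ∧ Tendsto u atTop (𝓝 μ) := by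
  have hf : ∀ n, MemLp (density μ₀ (u n)) 1 (μ₀ : Measure X) :=
    fun n => memLp_one_iff_integrable.2 integrable_density
  have hB : ∑' N : ℕ, ENNReal.ofReal ((1 / 2) ^ N) ≠ ⊤ := by
    rw [← ENNReal.ofReal_tsum_of_nonneg (fun _ => by positivity) summable_geometric_two]
    exact ENNReal.ofReal_ne_top
  have hcau : ∀ N n m : ℕ, N ≤ n → N ≤ m →
      eLpNorm (density μ₀ (u n) - density μ₀ (u m)) 1 (μ₀ : Measure X)
        < ENNReal.ofReal ((1 / 2) ^ N) := by
    intro N n m hn hm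
    rw [eLpNorm_one_eq_lintegral_enorm, ← ofReal_integral_norm_eq_lintegral_enorm
      (integrable_density.sub integrable_density), ENNReal.ofReal_lt_ofReal_iff (by positivity)]
    exact hc N n m hn hm
  obtain ⟨g, hg, hlim⟩ := exists_stronglyMeasurable_limit_of_tendsto_ae (fun n => (hf n).1)
    (Lp.ae_tendsto_of_cauchy_eLpNorm (fun n => (hf n).1) le_rfl hB hcau)
  -- The limit is nonnegative only almost everywhere; the absolute value makes it so everywhere.
  set f : X → ℝ := fun x => |g x| with hfdef
  have hfm : Measurable f := hg.measurable.abs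
  have hf0 : ∀ x, 0 ≤ f x := fun x => abs_nonneg _
  have hflim : ∀ᵐ x ∂(μ₀ : Measure X),
      Tendsto (fun n => density μ₀ (u n) x) atTop (𝓝 (f x)) := by
    filter_upwards [hlim] with x hx
    simpa only [abs_of_nonneg (density_nonneg _)] using hx.abs
  have hL1 := Lp.cauchy_tendsto_of_tendsto (fun n => (hf n).1) f hB hcau hflim
  have hfi : Integrable f μ₀ :=
    memLp_one_iff_integrable.1 (Lp.memLp_of_cauchy_tendsto le_rfl hf f hfm.aestronglyMeasurable hL1)
  have hint : ∫ x, f x ∂μ₀ = 1 := by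
    have h := tendsto_integral_of_L1' f hfm.aestronglyMeasurable
      (Eventually.of_forall fun n => integrable_density) hL1
    simp only [(hu _).integral_density] at h
    exact tendsto_nhds_unique h tendsto_const_nhds
  have hfE : Measurable fun x => ENNReal.ofReal (f x) := hfm.ennreal_ofReal
  have hprob : IsProbabilityMeasure
      ((μ₀ : Measure X).withDensity fun x => ENNReal.ofReal (f x)) := by
    constructor
    rw [withDensity_apply _ MeasurableSet.univ, Measure.restrict_univ,
      ← ofReal_integral_eq_lintegral_ofReal hfi (ae_of_all _ hf0), hint, ENNReal.ofReal_one]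
  let μ : ProbabilityMeasure X := ⟨_, hprob⟩
  have hμ : (μ : Measure X) = (μ₀ : Measure X).withDensity fun x => ENNReal.ofReal (f x) := rfl
  have hac : (μ : Measure X) ≪ μ₀ := withDensity_absolutelyContinuous _ _
  have hdens : density μ₀ μ =ᵐ[(μ₀ : Measure X)] f := by
    filter_upwards [Measure.rnDeriv_withDensity (μ₀ : Measure X) hfE] with x hx
    rw [density, hμ, hx, ENNReal.toReal_ofReal (hf0 x)]
  have hkl : klDiv (μ : Measure X) (μ₀ : Measure X) ≤ ENNReal.ofReal d := by
    rw [klDiv_eq_lintegral_klFun_of_ac hac]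
    calc ∫⁻ x, ENNReal.ofReal (klFun ((μ : Measure X).rnDeriv μ₀ x).toReal) ∂μ₀
        = ∫⁻ x, liminf (fun n => ENNReal.ofReal (klFun (density μ₀ (u n) x))) atTop ∂μ₀ := by
          refine lintegral_congr_ae ?_
          filter_upwards [hdens, hflim] with x h1 h2
          change ENNReal.ofReal (klFun (density μ₀ μ x)) = _
          rw [h1]
          exact ((ENNReal.continuous_ofReal.comp continuous_klFun).continuousAt.tendsto.comp
            h2).liminf_eq.symm
      _ ≤ liminf (fun n => ∫⁻ x, ENNReal.ofReal (klFun (density μ₀ (u n) x)) ∂μ₀) atTop :=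
          lintegral_liminf_le fun n => (measurable_klFun.comp measurable_density).ennreal_ofReal
      _ = ENNReal.ofReal d := by
          simp only [(hu _).lintegral_klFun]
          exact ((ENNReal.continuous_ofReal.tendsto _).comp hd).liminf_eq
  have hfin : FiniteEntropy μ₀ μ := ne_top_of_le_ne_top ENNReal.ofReal_ne_top hkl
  have hd0 : 0 ≤ d := ge_of_tendsto' hd fun n => kl_nonneg
  refine ⟨μ, hfin, (ENNReal.toReal_le_of_le_ofReal hd0 hkl), ?_⟩
  rw [ProbabilityMeasure.tendsto_iff_forall_integral_tendsto]
  intro φ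
  have h1 : ∫ x, φ x ∂μ = ∫ x, f x * φ x ∂μ₀ := by
    rw [← hfin.integral_mul_density]
    refine integral_congr_ae ?_
    filter_upwards [hdens] with x hx
    rw [hx]
  have hφ : ∀ h : X → ℝ, Integrable h μ₀ → Integrable (fun x => h x * φ x) μ₀ := fun h hh =>
    hh.mul_bdd (c := ‖φ‖) φ.continuous.measurable.aestronglyMeasurable (ae_of_all _ fun x => φ.norm_coe_le_norm x)
  simp only [h1, ← (hu _).integral_mul_density]
  refine tendsto_integral_of_L1 _ (hφ f hfi).aestronglyMeasurable
    (Eventually.of_forall fun n => hφ _ integrable_density) ?_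
  have h2 : Tendsto (fun n => ‖φ‖ₑ * eLpNorm (density μ₀ (u n) - f) 1 (μ₀ : Measure X)) atTop
      (𝓝 0) := by
    simpa using ENNReal.Tendsto.const_mul hL1 (Or.inr enorm_ne_top)
  refine tendsto_of_tendsto_of_tendsto_of_le_of_le tendsto_const_nhds h2 (fun _ => zero_le)
    fun n => ?_
  rw [eLpNorm_one_eq_lintegral_enorm, ← lintegral_const_mul' _ _ enorm_ne_top]
  refine lintegral_mono fun x => ?_
  rw [← sub_mul, enorm_mul, mul_comm]
  gcongr
  · exact enorm_le_iff_norm_le.2 (φ.norm_coe_le_norm x)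
  · rfl

/-- A convex, sequentially closed set of probability measures contains a measure of least
Kullback-Leibler divergence. -/
lemma exists_kl_minimizer [TopologicalSpace X] [OpensMeasurableSpace X]
    {C : Set (ProbabilityMeasure X)} (hC : IsSeqClosed C)
    (hconv : ∀ μ ∈ C, ∀ ν ∈ C, ∀ (a b : ℝ≥0) (hab : a + b = 1), mix a b hab μ ν ∈ C)
    (hne : ∃ μ ∈ C, FiniteEntropy μ₀ μ) :
    ∃ μ ∈ C, FiniteEntropy μ₀ μ ∧ ∀ ν ∈ C, FiniteEntropy μ₀ ν → kl μ₀ μ ≤ kl μ₀ ν := by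
  set S : Set ℝ := kl μ₀ '' {μ | μ ∈ C ∧ FiniteEntropy μ₀ μ} with hS
  have hSne : S.Nonempty := by
    obtain ⟨μ, h1, h2⟩ := hne
    exact ⟨_, μ, ⟨h1, h2⟩, rfl⟩
  have hSb : BddBelow S := ⟨0, by rintro _ ⟨μ, -, rfl⟩; exact kl_nonneg⟩
  set d := sInf S with hd
  have hdle : ∀ ν ∈ C, FiniteEntropy μ₀ ν → d ≤ kl μ₀ ν :=
    fun ν h1 h2 => csInf_le hSb ⟨ν, ⟨h1, h2⟩, rfl⟩
  -- The tolerance matches the midpoint gap `(L/4)²`: midpoints stay in `C`, so their divergence is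
  -- at least `d`, which forces `L < 2⁻ᴺ`.
  have hseq : ∀ n : ℕ, ∃ μ, (μ ∈ C ∧ FiniteEntropy μ₀ μ) ∧
      kl μ₀ μ < d + (1 / 4 * (1 / 2) ^ n) ^ 2 := by
    intro n
    obtain ⟨_, ⟨μ, hμ, rfl⟩, h⟩ := exists_lt_of_csInf_lt hSne
      (lt_add_of_pos_right d (by positivity : (0 : ℝ) < (1 / 4 * (1 / 2) ^ n) ^ 2))
    exact ⟨μ, hμ, h⟩
  choose u hu hlt using hseq
  have hlim : Tendsto (fun n => kl μ₀ (u n)) atTop (𝓝 d) := by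
    refine tendsto_of_tendsto_of_tendsto_of_le_of_le tendsto_const_nhds ?_
      (fun n => hdle _ (hu n).1 (hu n).2) (fun n => (hlt n).le)
    have h := ((tendsto_pow_atTop_nhds_zero_of_lt_one (by norm_num : (0 : ℝ) ≤ 1 / 2)
      (by norm_num)).const_mul (1 / 4)).pow 2 |>.const_add d
    simpa using h
  obtain ⟨μ, h1, h2, h3⟩ := exists_tendsto_of_cauchy_density (fun n => (hu n).2) hlim (by
    intro N n m hn hm
    set L := ∫ x, |density μ₀ (u n) x - density μ₀ (u m) x| ∂μ₀
    have hhalf : (1 / 2 : ℝ≥0) + 1 / 2 = 1 := add_halves 1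
    have h := kl_mix_add_le (hu n).2 (hu m).2 (1 / 2) (1 / 2) hhalf
    have h' := hdle _ (hconv _ (hu n).1 _ (hu m).1 _ _ hhalf) ((hu n).2.mix (hu m).2 _ _ hhalf)
    have hmono : ∀ k, N ≤ k → (1 / 4 * (1 / 2 : ℝ) ^ k) ^ 2 ≤ (1 / 4 * (1 / 2 : ℝ) ^ N) ^ 2 := by
      intro k hk
      have : (1 / 2 : ℝ) ^ k ≤ (1 / 2) ^ N := pow_le_pow_of_le_one (by norm_num) (by norm_num) hk
      gcongr
    have hn' := (hlt n).trans_le (add_le_add_right (hmono n hn) d)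
    have hm' := (hlt m).trans_le (add_le_add_right (hmono m hm) d)
    push_cast at h
    have hsq : (1 / 2 * (1 / 2) * L) ^ 2 < (1 / 4 * (1 / 2 : ℝ) ^ N) ^ 2 := by linarith
    have := lt_of_pow_lt_pow_left₀ 2 (by positivity) hsq
    linarith)
  exact ⟨μ, hC (fun n => (hu n).1) h3, h1, fun ν hν hνf => h2.trans (hdle ν hν hνf)⟩

end MeanField

/-! ### Energy along segments -/

namespace MeanField
open InformationTheory

variable {X : Type*} [MeasurableSpace X] {μ₀ μ ν : ProbabilityMeasure X}
  {E : ProbabilityMeasure X → EReal}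

lemma IsConvexFunctional.le_of_le (hE : IsConvexFunctional E) {x y : ℝ} (hμ : E μ ≤ (x : EReal))
    (hν : E ν ≤ (y : EReal)) (a b : ℝ≥0) (hab : a + b = 1) :
    E (mix a b hab μ ν) ≤ ((a * x + b * y : ℝ) : EReal) := by
  refine (hE μ ν a b hab).trans ?_
  have ha : (0 : EReal) ≤ ((a : ℝ) : EReal) := EReal.coe_nonneg.2 a.2
  have hb : (0 : EReal) ≤ ((b : ℝ) : EReal) := EReal.coe_nonneg.2 b.2
  push_cast
  gcongr

lemma isConvex_sublevel (hE : IsConvexFunctional E) (e : ℝ) :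
    ∀ μ ∈ {μ | E μ ≤ (e : EReal)}, ∀ ν ∈ {μ | E μ ≤ (e : EReal)}, ∀ (a b : ℝ≥0) (hab : a + b = 1),
      mix a b hab μ ν ∈ {μ | E μ ≤ (e : EReal)} := by
  intro μ hμ ν hν a b hab
  have h := hE.le_of_le hμ hν a b hab
  have habR : (a : ℝ) + b = 1 := by exact_mod_cast hab
  rwa [← add_mul, habR, one_mul] at h

/-- The segment from `μ` to `ν`. -/
noncomputable def segment (μ ν : ProbabilityMeasure X) (t : unitInterval) : ProbabilityMeasure X :=
  mix (unitInterval.toNNReal (unitInterval.symm t)) (unitInterval.toNNReal t) (by simp) μ ν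

@[simp] lemma segment_zero : segment μ ν 0 = μ := by
  apply Subtype.ext
  change (segment μ ν 0 : Measure X) = μ
  simp [segment, mix_toMeasure]

@[simp] lemma segment_one : segment μ ν 1 = ν := by
  apply Subtype.ext
  change (segment μ ν 1 : Measure X) = ν
  simp [segment, mix_toMeasure]

lemma segment_segment (s t : unitInterval) :
    segment (segment μ ν s) ν t
      = segment μ ν (unitInterval.symm (unitInterval.symm s * unitInterval.symm t)) := by
  apply Subtype.ext
  change (segment (segment μ ν s) ν t : Measure X) = (segment μ ν _ : Measure X)
  simp only [segment, mix_toMeasure, smul_add, smul_smul, add_assoc, ← add_smul]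
  congr 2
  · ext; simp; ring
  · ext; simp; ring

lemma continuous_segment [TopologicalSpace X] [OpensMeasurableSpace X] :
    Continuous (segment μ ν) := by
  rw [continuous_iff_continuousAt]
  intro t
  rw [ContinuousAt, ProbabilityMeasure.tendsto_iff_forall_integral_tendsto]
  intro φ
  have h : ∀ s : unitInterval, ∫ x, φ x ∂(segment μ ν s)
      = (1 - (s : ℝ)) * ∫ x, φ x ∂μ + s * ∫ x, φ x ∂ν := by
    intro s
    simp only [segment, mix_toMeasure]
    rw [integral_add_measure (φ.integrable _).smul_measure_nnreal
      (φ.integrable _).smul_measure_nnreal, integral_smul_nnreal_measure,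
      integral_smul_nnreal_measure]
    simp [NNReal.smul_def]
  simp only [h]
  have : Continuous fun s : unitInterval =>
      (1 - (s : ℝ)) * ∫ x, φ x ∂μ + s * ∫ x, φ x ∂ν := by fun_prop
  exact this.tendsto t

/-- Every energy value between `E μ` and a finite `E ν` is attained on the segment. -/
lemma exists_segment_energy_eq [TopologicalSpace X] [OpensMeasurableSpace X]
    (hbot : ∀ μ, E μ ≠ ⊥) (hlsc : LowerSemicontinuous E) (hconv : IsConvexFunctional E)
    (hν : E ν < ⊤) {e : ℝ} (h1 : E μ ≤ (e : EReal)) (h2 : (e : EReal) ≤ E ν) :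
    ∃ t : unitInterval, E (segment μ ν t) = (e : EReal) := by
  obtain ⟨e₀, he₀⟩ : ∃ r : ℝ, E ν = (r : EReal) :=
    ⟨_, (EReal.coe_toReal hν.ne (hbot ν)).symm⟩
  have hcl : IsClosed ((fun t => E (segment μ ν t)) ⁻¹' Set.Iic (e : EReal)) :=
    (hlsc.comp continuous_segment).isClosed_preimage _
  -- Take the last parameter with energy at most `e`. If the inequality were strict, convexity would
  -- allow a further step towards `ν`, contradicting maximality.
  obtain ⟨t, ht, hmax⟩ := hcl.isCompact.exists_isGreatest ⟨0, by simpa using h1⟩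
  refine ⟨t, le_antisymm ht (not_lt.1 fun hlt => ?_)⟩
  obtain ⟨x, hx⟩ : ∃ r : ℝ, E (segment μ ν t) = (r : EReal) :=
    ⟨_, (EReal.coe_toReal hlt.ne_top (hbot _)).symm⟩
  rw [hx] at hlt
  rw [he₀] at h2
  have hxe : x < e := EReal.coe_lt_coe_iff.1 hlt
  have hee : e ≤ e₀ := EReal.coe_le_coe_iff.1 h2
  -- The parameter at which the chord from `x` to `e₀` takes the value `e`.
  let s : unitInterval := ⟨(e - x) / (e₀ - x), unitInterval.div_mem (by linarith) (by linarith)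
    (by linarith)⟩
  have hs : (s : ℝ) = (e - x) / (e₀ - x) := rfl
  have hs0 : (0 : ℝ) < s := div_pos (by linarith) (by linarith)
  have hle : E (segment (segment μ ν t) ν s) ≤ (e : EReal) := by
    refine (hconv.le_of_le hx.le he₀.le _ _ _).trans (le_of_eq ?_)
    congr 1
    simp only [unitInterval.coe_toNNReal, unitInterval.coe_symm_eq]
    have : e₀ - x ≠ 0 := by linarith
    rw [hs]
    field_simp
    ring
  rw [segment_segment] at hle
  have h3 : (_ : unitInterval) ≤ t := hmax hle
  have h4 : 1 - (1 - (t : ℝ)) * (1 - s) ≤ t := by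
    simpa using Subtype.coe_le_coe.2 h3
  have h5 : (1 : ℝ) ≤ t := by
    by_contra h
    nlinarith [mul_pos hs0 (by linarith : (0 : ℝ) < 1 - t)]
  have h6 : t = 1 := Subtype.ext (le_antisymm t.2.2 h5)
  rw [h6, segment_one, he₀, EReal.coe_eq_coe_iff] at hx
  linarith

end MeanField

/-! ### Entropy maximizers, concavity, duality and continuity -/

namespace MeanField
open InformationTheory

variable {X : Type*} [MeasurableSpace X] {μ₀ μ ν : ProbabilityMeasure X}
  {E : ProbabilityMeasure X → EReal} {e : ℝ}

/-- `μ` has energy `e`, finite entropy, and maximal entropy among the measures of energy at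
most `e`. -/
structure IsMaximizer (E : ProbabilityMeasure X → EReal) (μ₀ : ProbabilityMeasure X) (e : ℝ)
    (μ : ProbabilityMeasure X) : Prop where
  energy_eq : E μ = (e : EReal)
  finiteEntropy : FiniteEntropy μ₀ μ
  kl_le : ∀ ν, E ν ≤ (e : EReal) → FiniteEntropy μ₀ ν → kl μ₀ μ ≤ kl μ₀ ν

lemma IsMaximizer.entropy_eq (h : IsMaximizer E μ₀ e μ) :
    entropy E μ₀ e = ((-kl μ₀ μ : ℝ) : EReal) := by
  refine le_antisymm (iSup₂_le fun ν hν => ?_) ?_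
  · by_cases hf : FiniteEntropy μ₀ ν
    · rw [hf.relEntropy_eq, EReal.coe_le_coe_iff]
      exact neg_le_neg (h.kl_le ν hν.le hf)
    · rw [not_not.1 fun h' => hf (relEntropy_ne_bot_iff.1 h')]
      exact bot_le
  · rw [← h.finiteEntropy.relEntropy_eq]
    exact le_iSup₂ (f := fun ν (_ : E ν = (e : EReal)) => relEntropy μ₀ ν) μ h.energy_eq

lemma IsMaximizer.entropy_toReal (h : IsMaximizer E μ₀ e μ) :
    (entropy E μ₀ e).toReal = -kl μ₀ μ := by
  rw [h.entropy_eq, EReal.toReal_coe]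

lemma IsMaximizer.kl_pos (h : IsMaximizer E μ₀ e μ) (he : (e : EReal) < E μ₀) : 0 < kl μ₀ μ := by
  by_contra h0
  have := h.finiteEntropy.eq_of_kl_nonpos (not_lt.1 h0)
  rw [← this, h.energy_eq] at he
  exact lt_irrefl _ he

lemma isMaximizer_prior (he : E μ₀ = (e : EReal)) : IsMaximizer E μ₀ e μ₀ :=
  ⟨he, finiteEntropy_self, fun ν _ _ => by rw [kl_self]; exact kl_nonneg⟩

section Topological

variable [TopologicalSpace X] [OpensMeasurableSpace X]

/-- Approximate a measure of energy below `e`; convergence of the energies keeps the strict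
inequality eventually. -/
lemma EnergyApproximation.exists_finiteEntropy_lt (hE : EnergyApproximation E μ₀)
    (he : eMin E < (e : EReal)) : ∃ μ, FiniteEntropy μ₀ μ ∧ E μ < (e : EReal) := by
  obtain ⟨μ, hμ⟩ := iInf_lt_iff.1 he
  obtain ⟨ν, -, hν, hlim⟩ := hE μ
  obtain ⟨j, hj⟩ := (hlim.eventually_lt_const hμ).exists
  exact ⟨ν j, relEntropy_ne_bot_iff.1 (hν j).2, hj⟩

lemma exists_isMaximizer (hbot : ∀ μ, E μ ≠ ⊥) (hlsc : LowerSemicontinuous E)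
    (hconv : IsConvexFunctional E) (he₀ : E μ₀ < ⊤) (happ : EnergyApproximation E μ₀)
    (h1 : eMin E < (e : EReal)) (h2 : (e : EReal) ≤ E μ₀) : ∃ μ, IsMaximizer E μ₀ e μ := by
  obtain ⟨ν, hνf, hν⟩ := happ.exists_finiteEntropy_lt h1
  obtain ⟨μ, hμ, hμf, hmin⟩ := exists_kl_minimizer (μ₀ := μ₀) (C := {μ | E μ ≤ (e : EReal)})
    (hlsc.isClosed_preimage _).isSeqClosed (isConvex_sublevel hconv e) ⟨ν, hν.le, hνf⟩
  obtain ⟨t, ht⟩ := exists_segment_energy_eq hbot hlsc hconv he₀ hμ h2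
  refine ⟨segment μ μ₀ t, ht, hμf.mix finiteEntropy_self _ _ _, fun ρ hρ hρf => ?_⟩
  -- Since `kl μ₀ μ₀ = 0`, convexity bounds the divergence at `t` by `(1 - t) * kl μ₀ μ`.
  refine le_trans ?_ (hmin ρ hρ hρf)
  refine (kl_mix_le hμf finiteEntropy_self _ _ _).trans ?_
  rw [kl_self, mul_zero, add_zero]
  exact mul_le_of_le_one_left kl_nonneg (by simpa using t.2.1)

end Topological

/-- Concavity inequality for maximizers of the entropy. -/
lemma IsMaximizer.kl_le_mix (hconv : IsConvexFunctional E) {m : ProbabilityMeasure X}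
    {x y : ℝ} {a b : ℝ≥0} {hab : a + b = 1} (hm : IsMaximizer E μ₀ e m) (he : a * x + b * y ≤ e)
    (hμ : E μ ≤ (x : EReal)) (hν : E ν ≤ (y : EReal)) (hμf : FiniteEntropy μ₀ μ)
    (hνf : FiniteEntropy μ₀ ν) : kl μ₀ m ≤ kl μ₀ (mix a b hab μ ν) :=
  hm.kl_le _ ((hconv.le_of_le hμ hν a b hab).trans (EReal.coe_le_coe_iff.2 he))
    (hμf.mix hνf a b hab)

lemma convex_coe_preimage {s : Set EReal} (hs : s.OrdConnected) :
    Convex ℝ ((fun x : ℝ => (x : EReal)) ⁻¹' s) :=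
  (hs.preimage_mono EReal.coe_strictMono.monotone).convex

/-- The mixture of two maximizers has energy at most the mixed value, so it competes in the relaxed
problem there. The endpoint `e₀` is included for use in the continuity proof. -/
lemma strictConcaveOn_entropy (hconv : IsConvexFunctional E)
    (hmax : ∀ e : ℝ, eMin E < (e : EReal) → (e : EReal) ≤ E μ₀ → ∃ μ, IsMaximizer E μ₀ e μ) :
    StrictConcaveOn ℝ {e : ℝ | eMin E < (e : EReal) ∧ (e : EReal) ≤ E μ₀}
      (fun e => (entropy E μ₀ e).toReal) := by
  refine ⟨convex_coe_preimage (s := Set.Ioc (eMin E) (E μ₀)) Set.ordConnected_Ioc, ?_⟩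
  intro x hx y hy hxy a b ha hb hab
  have hz := convex_coe_preimage (s := Set.Ioc (eMin E) (E μ₀)) Set.ordConnected_Ioc hx hy ha.le
    hb.le hab
  obtain ⟨μ, hμ⟩ := hmax x hx.1 hx.2
  obtain ⟨ν, hν⟩ := hmax y hy.1 hy.2
  obtain ⟨m, hm⟩ := hmax _ hz.1 hz.2
  have hne : μ ≠ ν := by
    rintro rfl
    exact hxy (EReal.coe_eq_coe_iff.1 (hμ.energy_eq.symm.trans hν.energy_eq))
  lift a to ℝ≥0 using ha.le
  lift b to ℝ≥0 using hb.le
  have hab' : a + b = 1 := by exact_mod_cast hab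
  have h1 := hm.kl_le_mix (hab := hab') hconv le_rfl hμ.energy_eq.le hν.energy_eq.le
    hμ.finiteEntropy hν.finiteEntropy
  have h2 := kl_mix_lt hμ.finiteEntropy hν.finiteEntropy hne (NNReal.coe_pos.1 ha)
    (NNReal.coe_pos.1 hb) hab'
  beta_reduce
  rw [hμ.entropy_toReal, hν.entropy_toReal, hm.entropy_toReal]
  simp only [smul_eq_mul]
  linarith

/-- Slopes of the entropy to the left of `e` dominate those to the right. -/
lemma IsMaximizer.slope_le (hconv : IsConvexFunctional E) {m : ProbabilityMeasure X} {x y : ℝ}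
    (hm : IsMaximizer E μ₀ e m) (hμ : E μ = (x : EReal)) (hν : E ν = (y : EReal))
    (hμf : FiniteEntropy μ₀ μ) (hνf : FiniteEntropy μ₀ ν) (hx : x < e) (hy : e < y) :
    (kl μ₀ m - kl μ₀ ν) / (y - e) ≤ (kl μ₀ μ - kl μ₀ m) / (e - x) := by
  have hxy : 0 < y - x := by linarith
  let a : ℝ≥0 := ⟨(y - e) / (y - x), div_nonneg (by linarith) hxy.le⟩
  let b : ℝ≥0 := ⟨(e - x) / (y - x), div_nonneg (by linarith) hxy.le⟩
  have ha : (a : ℝ) = (y - e) / (y - x) := rfl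
  have hb : (b : ℝ) = (e - x) / (y - x) := rfl
  have hab : a + b = 1 := by
    apply NNReal.coe_injective
    push_cast
    rw [ha, hb]
    field_simp
    ring
  have he : a * x + b * y ≤ e := by
    rw [ha, hb]
    refine le_of_eq ?_
    field_simp
    ring
  have h := (hm.kl_le_mix (hab := hab) hconv he hμ.le hν.le hμf hνf).trans
    (kl_mix_le hμf hνf a b hab)
  rw [ha, hb, div_mul_eq_mul_div, div_mul_eq_mul_div, ← add_div, le_div_iff₀ hxy] at h
  rw [div_le_div_iff₀ (by linarith) (by linarith)]
  linarith

lemma FiniteEntropy.freeEnergyFunctional_eq (h : FiniteEntropy μ₀ μ) (β : ℝ) :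
    freeEnergyFunctional E μ₀ β μ = (β : EReal) * E μ + ((kl μ₀ μ : ℝ) : EReal) := by
  rw [freeEnergyFunctional, if_neg (relEntropy_ne_bot_iff.2 h), h.relEntropy_eq, EReal.coe_neg,
    sub_eq_add_neg, neg_neg]

/-- The entropy has a positive supergradient at every `e < E μ₀`. -/
lemma IsMaximizer.exists_le_freeEnergy (hbot : ∀ μ, E μ ≠ ⊥) (hconv : IsConvexFunctional E)
    (he₀ : E μ₀ < ⊤) {m : ProbabilityMeasure X} (hm : IsMaximizer E μ₀ e m)
    (hlow : ∃ μ, FiniteEntropy μ₀ μ ∧ E μ < (e : EReal)) (he : (e : EReal) < E μ₀) :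
    ∃ β : ℝ, ((β * e + kl μ₀ m : ℝ) : EReal) ≤ freeEnergy E μ₀ β := by
  obtain ⟨y₀, hy₀⟩ : ∃ r : ℝ, E μ₀ = (r : EReal) := ⟨_, (EReal.coe_toReal he₀.ne (hbot _)).symm⟩
  have hey₀ : e < y₀ := by rw [hy₀] at he; exact EReal.coe_lt_coe_iff.1 he
  -- Difference quotients from the left of `e`. Their infimum is the supergradient `β`; every
  -- quotient from the right bounds it below, and the one given by `μ₀` makes it positive.
  set S : Set ℝ := {r | ∃ μ, ∃ x : ℝ, FiniteEntropy μ₀ μ ∧ E μ = (x : EReal) ∧ x < e ∧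
    r = (kl μ₀ μ - kl μ₀ m) / (e - x)} with hS
  have hlb : ∀ ν, ∀ y : ℝ, FiniteEntropy μ₀ ν → E ν = (y : EReal) → e < y →
      ∀ r ∈ S, (kl μ₀ m - kl μ₀ ν) / (y - e) ≤ r := by
    rintro ν y hνf hν hy _ ⟨μ, x, hμf, hμ, hx, rfl⟩
    exact hm.slope_le hconv hμ hν hμf hνf hx hy
  have hSne : S.Nonempty := by
    obtain ⟨μ, hμf, hμ⟩ := hlow
    have hx := (EReal.coe_toReal hμ.ne_top (hbot μ)).symm
    refine ⟨_, μ, _, hμf, hx, ?_, rfl⟩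
    rw [hx] at hμ
    exact EReal.coe_lt_coe_iff.1 hμ
  have hSb : BddBelow S := ⟨_, fun r hr => hlb μ₀ y₀ finiteEntropy_self hy₀ hey₀ r hr⟩
  have hβ : 0 < sInf S := by
    refine lt_of_lt_of_le ?_ (le_csInf hSne (hlb μ₀ y₀ finiteEntropy_self hy₀ hey₀))
    rw [kl_self, sub_zero]
    exact div_pos (hm.kl_pos he) (by linarith)
  refine ⟨sInf S, le_iInf fun μ => ?_⟩
  by_cases hμf : FiniteEntropy μ₀ μ
  swap
  · rw [freeEnergyFunctional, if_pos (not_not.1 fun h' => hμf (relEntropy_ne_bot_iff.1 h'))]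
    exact le_top
  rw [hμf.freeEnergyFunctional_eq]
  by_cases htop : E μ = ⊤
  -- Positivity of `β` is what disposes of measures of infinite energy.
  · rw [htop, EReal.coe_mul_top_of_pos hβ, EReal.top_add_coe]
    exact le_top
  obtain ⟨x, hx⟩ : ∃ r : ℝ, E μ = (r : EReal) := ⟨_, (EReal.coe_toReal htop (hbot _)).symm⟩
  rw [hx]
  norm_cast
  rcases lt_trichotomy x e with h | rfl | h
  · have h1 := csInf_le hSb ⟨μ, x, hμf, hx, h, rfl⟩
    rw [le_div_iff₀ (by linarith)] at h1
    linarith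
  · linarith [hm.kl_le μ hx.le hμf]
  · have h1 := le_csInf hSne (hlb μ x hμf hx h)
    rw [div_le_iff₀ (by linarith)] at h1
    linarith

/-- Testing `F(β)` on `m` gives `S(e) ≤ F*(e)` for free; the supergradient is a `β` at which the
infimum is attained. -/
lemma IsMaximizer.entropy_eq_legendre {m : ProbabilityMeasure X} (hm : IsMaximizer E μ₀ e m)
    (hβ : ∃ β : ℝ, ((β * e + kl μ₀ m : ℝ) : EReal) ≤ freeEnergy E μ₀ β) :
    entropy E μ₀ e = legendre (freeEnergy E μ₀) e := by
  rw [hm.entropy_eq]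
  refine le_antisymm (le_iInf fun β => ?_) ?_
  · have h : freeEnergy E μ₀ β ≤ ((β * e + kl μ₀ m : ℝ) : EReal) := by
      refine (iInf_le _ m).trans (le_of_eq ?_)
      rw [hm.finiteEntropy.freeEnergyFunctional_eq, hm.energy_eq]
      norm_cast
    calc ((-kl μ₀ m : ℝ) : EReal) = ((β * e : ℝ) : EReal) - ((β * e + kl μ₀ m : ℝ) : EReal) := by
          rw [← EReal.coe_sub]; congr 1; ring
      _ ≤ _ := EReal.sub_le_sub le_rfl h
  · obtain ⟨β, hβ⟩ := hβ
    refine (iInf_le _ β).trans ?_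
    calc ((β * e : ℝ) : EReal) - freeEnergy E μ₀ β
        ≤ ((β * e : ℝ) : EReal) - ((β * e + kl μ₀ m : ℝ) : EReal) := EReal.sub_le_sub le_rfl hβ
      _ = _ := by rw [← EReal.coe_sub]; congr 1; ring

lemma continuousOn_entropy (hconv : IsConvexFunctional E)
    (hmax : ∀ e : ℝ, eMin E < (e : EReal) → (e : EReal) ≤ E μ₀ → ∃ μ, IsMaximizer E μ₀ e μ) :
    ContinuousOn (entropy E μ₀) {e : ℝ | eMin E < (e : EReal) ∧ (e : EReal) ≤ E μ₀} := by
  set J : Set ℝ := {e : ℝ | eMin E < (e : EReal) ∧ (e : EReal) ≤ E μ₀} with hJ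
  have hconc := (strictConcaveOn_entropy hconv hmax).concaveOn
  have hcoe : ∀ e ∈ J, entropy E μ₀ e = (((entropy E μ₀ e).toReal : ℝ) : EReal) := by
    intro e he
    obtain ⟨μ, hμ⟩ := hmax e he.1 he.2
    rw [hμ.entropy_toReal, hμ.entropy_eq]
  suffices h : ContinuousOn (fun e => (entropy E μ₀ e).toReal) J from
    (continuous_coe_real_ereal.comp_continuousOn h).congr hcoe
  intro e he
  rcases he.2.lt_or_eq with hlt | heq
  · have hopen : IsOpen {r : ℝ | eMin E < (r : EReal) ∧ (r : EReal) < E μ₀} :=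
      isOpen_Ioo.preimage continuous_coe_real_ereal
    have hint : e ∈ interior J :=
      mem_interior.2 ⟨_, fun r hr => ⟨hr.1, hr.2.le⟩, hopen, ⟨he.1, hlt⟩⟩
    exact (hconc.continuousOn_interior.continuousAt
      (isOpen_interior.mem_nhds hint)).continuousWithinAt
  -- At `e = e₀` the entropy vanishes; nearby it lies between the chord from `x` and `0`.
  · obtain ⟨x, hx1, hx2⟩ := EReal.lt_iff_exists_real_btwn.1 he.1
    have hxe : x < e := EReal.coe_lt_coe_iff.1 hx2
    have hxJ : x ∈ J := ⟨hx1, (hx2.le).trans he.2⟩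
    have hze : (entropy E μ₀ e).toReal = 0 := by
      rw [(isMaximizer_prior heq.symm).entropy_toReal, kl_self, neg_zero]
    rw [ContinuousWithinAt, hze]
    have hg : Tendsto (fun r => (e - r) / (e - x) * (entropy E μ₀ x).toReal) (𝓝[J] e) (𝓝 0) := by
      have hc : Continuous fun r : ℝ => (e - r) / (e - x) * (entropy E μ₀ x).toReal := by fun_prop
      simpa using (hc.tendsto e).mono_left nhdsWithin_le_nhds
    refine tendsto_of_tendsto_of_tendsto_of_le_of_le' hg tendsto_const_nhds ?_ ?_
    · filter_upwards [self_mem_nhdsWithin, mem_nhdsWithin_of_mem_nhds (Ioi_mem_nhds hxe)]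
        with r hr hxr
      have hre : r ≤ e := by
        have := hr.2
        rw [← heq] at this
        exact EReal.coe_le_coe_iff.1 this
      have hpos : 0 < e - x := by linarith
      have hxr' : x < r := hxr
      have h := hconc.2 hxJ he (div_nonneg (by linarith : 0 ≤ e - r) hpos.le)
        (div_nonneg (by linarith : 0 ≤ r - x) hpos.le) (by field_simp; ring)
      simp only [smul_eq_mul, hze, mul_zero, add_zero] at h
      refine h.trans (le_of_eq ?_)
      congr 2
      field_simp
      ring
    · filter_upwards [self_mem_nhdsWithin] with r hr
      obtain ⟨μ, hμ⟩ := hmax r hr.1 hr.2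
      rw [hμ.entropy_toReal]
      exact neg_nonpos.2 kl_nonneg

end MeanField

theorem mainTheorem11 {X : Type*} [TopologicalSpace X] [CompactSpace X] [MeasurableSpace X]
    [BorelSpace X] (μ₀ : ProbabilityMeasure X) (E : ProbabilityMeasure X → EReal)
    (hE_bot : ∀ μ, E μ ≠ ⊥) (hE_lsc : LowerSemicontinuous E)
    (hE_conv : MeanField.IsConvexFunctional E) (he₀ : E μ₀ < ⊤)
    (hE_approx : MeanField.EnergyApproximation E μ₀) :
    (∀ e : ℝ, MeanField.eMin E < (e : EReal) → (e : EReal) ≤ E μ₀ →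
      MeanField.entropy E μ₀ e ≠ ⊥ ∧ MeanField.entropy E μ₀ e ≠ ⊤) ∧
    StrictConcaveOn ℝ {e : ℝ | MeanField.eMin E < (e : EReal) ∧ (e : EReal) < E μ₀}
      (fun e => (MeanField.entropy E μ₀ e).toReal) ∧
    (∀ e : ℝ, MeanField.eMin E < (e : EReal) → (e : EReal) < E μ₀ →
      MeanField.entropy E μ₀ e = MeanField.legendre (MeanField.freeEnergy E μ₀) e) ∧
    ContinuousOn (MeanField.entropy E μ₀)
      {e : ℝ | MeanField.eMin E < (e : EReal) ∧ (e : EReal) ≤ E μ₀} := by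
  have hmax : ∀ e : ℝ, MeanField.eMin E < (e : EReal) → (e : EReal) ≤ E μ₀ →
      ∃ μ, MeanField.IsMaximizer E μ₀ e μ := fun e h1 h2 =>
    MeanField.exists_isMaximizer hE_bot hE_lsc hE_conv he₀ hE_approx h1 h2
  refine ⟨fun e h1 h2 => ?_, ?_, fun e h1 h2 => ?_, MeanField.continuousOn_entropy hE_conv hmax⟩
  · obtain ⟨μ, hμ⟩ := hmax e h1 h2
    rw [hμ.entropy_eq]
    exact ⟨EReal.coe_ne_bot _, EReal.coe_ne_top _⟩
  · exact (MeanField.strictConcaveOn_entropy hE_conv hmax).subset (fun e he => ⟨he.1, he.2.le⟩)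
      (MeanField.convex_coe_preimage (s := Set.Ioo (MeanField.eMin E) (E μ₀)) Set.ordConnected_Ioo)
  · obtain ⟨m, hm⟩ := hmax e h1 h2.le
    exact hm.entropy_eq_legendre (hm.exists_le_freeEnergy hE_bot hE_conv he₀
      (hE_approx.exists_finiteEntropy_lt h1) h2)
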